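/- Let $\mathcal{S}_m=\{x\in\mathbb{R}^m : x_1\ge\sqrt{x_2^2+\dots+x_m^2}\}$ be the second order cone in $\mathbb{R}^m$, $m\ge 1$. Let $K=\mathcal{S}_{m_1}\times\dots\times\mathcal{S}_{m_t}$, let $A$ be a real matrix with $n$ columns $a_1,\dots,a_n$ and $m_1+\dots+m_t$ rows, let $b\in\mathbb{R}^{m_1+\dots+m_t}$, and write $u\le_K w$ for $w-u\in K$. The second order conic system $Ax\le_K b$ is called well-behaved if for every $c\in\mathbb{R}^n$ for which $v=\sup\{c^Tx : Ax\le_K b\}$ is finite there is a $y\in K^*=\{y : y^Tx\ge 0\ \ \forall x\in K\}$ with $A^Ty=c$ and $b^Ty=v$; otherwise it is called badly behaved. Consider the following elementary operations on such a system. 1. Rotation: for some invertible matrix $T$ with $TK=K$, replace $A$ by $TA$ and $b$ by $Tb$. 2. Contraction: replace a column $a_i$ of $A$ by $\sum_{j=1}^n\lambda_ja_j$ and replace $b$ by $b+\sum_{j=1}^n\mu_ja_j$, where $\lambda_j,\mu_j\in\mathbb{R}$ and $\lambda_i\ne 0$. 3. Row deletion: delete from $A$ and $b$ some rows none of which corresponds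 to the first component of one of the cones $\mathcal{S}_{m_i}$ (each $\mathcal{S}_{m_i}$ is replaced by the second order cone in the remaining components of its block), or delete all the rows of a block together with its cone $\mathcal{S}_{m_i}$. 4. Column deletion: delete a column $a_i$ of $A$. If the system $Ax\le_K b$ is badly behaved, then some finite sequence of these operations transforms it into the system $$x_1\begin{pmatrix}\alpha\\ \alpha\\ 1\end{pmatrix}\le_{\mathcal{S}_3}\begin{pmatrix}1\\ 1\\ 0\end{pmatrix}$$ in one variable, for some $\alpha\in\mathbb{R}$. -/

import Mathlib

open scoped Matrix

noncomputable section

/-- The second order cone in `ℝ^(d+1)`: the vectors whose first coordinate (index `0`) is at least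
the Euclidean norm of the remaining `d` coordinates. For `d = 0` it is the half-line `ℝ₊`. -/
def secondOrderCone (d : ℕ) : Set (Fin (d + 1) → ℝ) :=
  {x | Real.sqrt (∑ k : Fin d, x k.succ ^ 2) ≤ x 0}

/-- The product of the second order cones in `ℝ^(d 0 + 1), …, ℝ^(d (t-1) + 1)`. The coordinate
`⟨i, k⟩` is coordinate `k` of block `i`. -/
def prodSecondOrderCone {t : ℕ} (d : Fin t → ℕ) : Set ((Σ i : Fin t, Fin (d i + 1)) → ℝ) :=
  {x | ∀ i : Fin t, (fun k => x ⟨i, k⟩) ∈ secondOrderCone (d i)}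

section Conic

variable {ι κ : Type} [Fintype ι] [Fintype κ]

/-- The dual cone `K* = {y | ⟨y, x⟩ ≥ 0 for all x ∈ K}`. -/
def dualConeSet (K : Set (ι → ℝ)) : Set (ι → ℝ) :=
  {y | ∀ x ∈ K, 0 ≤ y ⬝ᵥ x}

/-- The solution set `{x | A x ≤_K b}` of a conic linear system, where `s ≤_K t` means
`t - s ∈ K`. -/
def conicFeasible (K : Set (ι → ℝ)) (A : Matrix ι κ ℝ) (b : ι → ℝ) : Set (κ → ℝ) :=
  {x | b - A *ᵥ x ∈ K}

/-- The system `A x ≤_K b` is well-behaved: whenever the value `v` of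
`sup {⟨c, x⟩ | A x ≤_K b}` is finite (the system is feasible and the objective is bounded above
on it, with real supremum `v`), the dual program
`inf {⟨b, y⟩ | y ∈ K*, Aᵀ y = c}` has a feasible solution with the same value. -/
def ConicWellBehaved (K : Set (ι → ℝ)) (A : Matrix ι κ ℝ) (b : ι → ℝ) : Prop :=
  ∀ (c : κ → ℝ) (v : ℝ), IsLUB ((fun x => c ⬝ᵥ x) '' conicFeasible K A b) v →
    ∃ y ∈ dualConeSet K, Aᵀ *ᵥ y = c ∧ b ⬝ᵥ y = v

end Conic

/-- The data of a second order conic system `A x ≤_K b` with `n` variables and `t` blocks, where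
`K` is the product of the second order cones in `ℝ^(d i + 1)`, `i < t`. -/
structure SOCSystem where
  n : ℕ
  t : ℕ
  d : Fin t → ℕ
  A : Matrix (Σ i : Fin t, Fin (d i + 1)) (Fin n) ℝ
  b : (Σ i : Fin t, Fin (d i + 1)) → ℝ

namespace SOCSystem

/-- A system is badly behaved if it is not well-behaved. -/
def BadlyBehaved (S : SOCSystem) : Prop :=
  ¬ ConicWellBehaved (prodSecondOrderCone S.d) S.A S.b

/-- One elementary operation on second order conic systems. -/
inductive Step : SOCSystem → SOCSystem → Prop
  /-- Rotation: multiply `A` and `b` by an invertible matrix `T` with `T K = K`. -/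
  | rotate {n t : ℕ} {d : Fin t → ℕ}
      (A : Matrix (Σ i : Fin t, Fin (d i + 1)) (Fin n) ℝ)
      (b : (Σ i : Fin t, Fin (d i + 1)) → ℝ)
      (T : Matrix (Σ i : Fin t, Fin (d i + 1)) (Σ i : Fin t, Fin (d i + 1)) ℝ)
      (hT : IsUnit T)
      (hK : (fun x => T *ᵥ x) '' prodSecondOrderCone d = prodSecondOrderCone d) :
      Step ⟨n, t, d, A, b⟩ ⟨n, t, d, T * A, T *ᵥ b⟩
  /-- Contraction: replace column `i` of `A` by the combination `A l` of the columns of `A`, where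
  `l i ≠ 0`, and replace `b` by `b + A m`. -/
  | contract {n t : ℕ} {d : Fin t → ℕ}
      (A : Matrix (Σ i : Fin t, Fin (d i + 1)) (Fin n) ℝ)
      (b : (Σ i : Fin t, Fin (d i + 1)) → ℝ)
      (i : Fin n) (l m : Fin n → ℝ) (hl : l i ≠ 0) :
      Step ⟨n, t, d, A, b⟩ ⟨n, t, d, A.updateCol i (A *ᵥ l), b + A *ᵥ m⟩
  /-- Deletion of rows other than the first rows of the blocks. In block `i` the rows in the range
  of the increasing map `f i` are kept, and they always include the first row. -/
  | deleteRows {n t : ℕ} {d d' : Fin t → ℕ}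
      (A : Matrix (Σ i : Fin t, Fin (d i + 1)) (Fin n) ℝ)
      (b : (Σ i : Fin t, Fin (d i + 1)) → ℝ)
      (f : ∀ i : Fin t, Fin (d' i + 1) ↪o Fin (d i + 1))
      (hf : ∀ i : Fin t, f i 0 = 0) :
      Step ⟨n, t, d, A, b⟩
        ⟨n, t, d', fun r j => A ⟨r.1, f r.1 r.2⟩ j, fun r => b ⟨r.1, f r.1 r.2⟩⟩
  /-- Deletion of all the rows of block `i`, together with its cone. -/
  | deleteBlock {n t : ℕ} {d : Fin (t + 1) → ℕ}
      (A : Matrix (Σ i : Fin (t + 1), Fin (d i + 1)) (Fin n) ℝ)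
      (b : (Σ i : Fin (t + 1), Fin (d i + 1)) → ℝ)
      (i : Fin (t + 1)) :
      Step ⟨n, t + 1, d, A, b⟩
        ⟨n, t, fun j => d (i.succAbove j),
          fun r j => A ⟨i.succAbove r.1, r.2⟩ j, fun r => b ⟨i.succAbove r.1, r.2⟩⟩
  /-- Deletion of column `i` of `A`. -/
  | deleteCol {n t : ℕ} {d : Fin t → ℕ}
      (A : Matrix (Σ i : Fin t, Fin (d i + 1)) (Fin (n + 1)) ℝ)
      (b : (Σ i : Fin t, Fin (d i + 1)) → ℝ)
      (i : Fin (n + 1)) :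
      Step ⟨n + 1, t, d, A, b⟩ ⟨n, t, d, fun r j => A r (i.succAbove j), b⟩

/-- `S` can be transformed into `S'` by finitely many elementary operations. -/
def ReducesTo (S S' : SOCSystem) : Prop :=
  Relation.ReflTransGen Step S S'

/-- The system `x₁ (α, α, 1)ᵀ ≤_K (1, 1, 0)ᵀ` in one variable, where `K` is the second order cone
in `ℝ³`. -/
def minor (α : ℝ) : SOCSystem where
  n := 1
  t := 1
  d := fun _ => 2
  A := fun r _ => (![α, α, 1] : Fin 3 → ℝ) r.2
  b := fun r => (![1, 1, 0] : Fin 3 → ℝ) r.2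

end SOCSystem

end

open Filter Topology

/-! ### Elementary operations: isolating a column or a block, and rotating -/

namespace SOCSystem

/-! Bad behaviour has a local cause: a slack `z = b - A x` with a block that is a nonzero boundary
point of its cone, and a vector `A u` whose block is tangent to the cone there but not a multiple of
that of `z`. Given such a pair, one contraction turns a column into `A u` and the right-hand side
into `z`. Deleting everything else leaves one column and one block, and a rotation to a normal form
exhibits the minor (`reducesTo_minor_of_tangent`).

The substance is that without such a pair strong duality holds
(`conicWellBehaved_of_tangent_eq_smul`). Choose a feasible slack `z` of maximal total rank. The map
`collapse` forgets interior blocks, keeps vanishing blocks, and retains only the Lorentz product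
with `z` in boundary blocks. If `A u` collapses into the cone, a small move from `z` along `A u`
stays feasible without lowering any rank, so by maximality the collapse of `A u` is zero. On the `u`
with zero collapse, feasibility coincides with membership in a relaxed cone having `z` as order
unit, so Slater duality gives a multiplier `y` valid for these `u`. The remaining part of the
objective factors through the collapse, whose range on `A u` meets the cone only at the origin.
Separation makes that factor nonnegative on the cone, and adding it to `y` costs nothing at `z`,
which collapses to zero. -/

theorem reducesTo_single_column {t : ℕ} {d : Fin t → ℕ} (n : ℕ)
    (A : Matrix (Σ i : Fin t, Fin (d i + 1)) (Fin n) ℝ)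
    (b : (Σ i : Fin t, Fin (d i + 1)) → ℝ) (j : Fin n) :
    ReducesTo ⟨n, t, d, A, b⟩ ⟨1, t, d, fun r _ => A r j, b⟩ := by
  induction n with
  | zero => exact j.elim0
  | succ n ih =>
    cases n with
    | zero =>
      have : A = fun r _ => A r j := by
        funext r k
        rw [show k = j from Fin.ext (by omega)]
      rw [← this]
      exact Relation.ReflTransGen.refl
    | succ n =>
      obtain ⟨k, hk⟩ := exists_ne j
      obtain ⟨l, rfl⟩ := Fin.exists_succAbove_eq hk.symm
      exact Relation.ReflTransGen.head (Step.deleteCol A b k) (ih _ l)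

theorem reducesTo_single_block {n : ℕ} (t : ℕ) (d : Fin t → ℕ)
    (A : Matrix (Σ i : Fin t, Fin (d i + 1)) (Fin n) ℝ)
    (b : (Σ i : Fin t, Fin (d i + 1)) → ℝ) (i : Fin t) :
    ReducesTo ⟨n, t, d, A, b⟩
      ⟨n, 1, fun _ => d i, fun r j => A ⟨i, r.2⟩ j, fun r => b ⟨i, r.2⟩⟩ := by
  induction t with
  | zero => exact i.elim0
  | succ t ih =>
    cases t with
    | zero =>
      obtain ⟨m, rfl⟩ : ∃ m, d = fun _ => m := ⟨d 0, funext fun k => by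
        rw [show k = 0 from Fin.ext (by omega)]⟩
      have hA : A = fun r j => A ⟨i, r.2⟩ j := by
        funext ⟨k, l⟩ j
        rw [show k = i from Fin.ext (by omega)]
      have hb : b = fun r => b ⟨i, r.2⟩ := by
        funext ⟨k, l⟩
        rw [show k = i from Fin.ext (by omega)]
      rw [← hA, ← hb]
      exact Relation.ReflTransGen.refl
    | succ t =>
      obtain ⟨k, hk⟩ := exists_ne i
      obtain ⟨l, rfl⟩ := Fin.exists_succAbove_eq hk.symm
      exact Relation.ReflTransGen.head (Step.deleteBlock A b k) (ih _ _ _ l)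

/-- Rotation by a linear automorphism of the cone. -/
theorem reducesTo_of_linearEquiv {n t : ℕ} {d : Fin t → ℕ}
    (A : Matrix (Σ i : Fin t, Fin (d i + 1)) (Fin n) ℝ)
    (b : (Σ i : Fin t, Fin (d i + 1)) → ℝ)
    (e : ((Σ i : Fin t, Fin (d i + 1)) → ℝ) ≃ₗ[ℝ] ((Σ i : Fin t, Fin (d i + 1)) → ℝ))
    (he : ∀ x, e x ∈ prodSecondOrderCone d ↔ x ∈ prodSecondOrderCone d) :
    ReducesTo ⟨n, t, d, A, b⟩ ⟨n, t, d, fun r j => e (fun s => A s j) r, e b⟩ := by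
  have hmul : ∀ x, LinearMap.toMatrix' e.toLinearMap *ᵥ x = e x := fun x => by
    rw [LinearMap.toMatrix'_mulVec]; rfl
  have hA : LinearMap.toMatrix' e.toLinearMap * A = fun r j => e (fun s => A s j) r := by
    funext r j
    rw [← hmul]
    rfl
  have h := Step.rotate A b (LinearMap.toMatrix' e.toLinearMap)
    (IsUnit.of_mul_eq_one (LinearMap.toMatrix' e.symm.toLinearMap) (by
      rw [← LinearMap.toMatrix'_comp]; simp))
    (by
      ext x
      simp only [hmul, Set.mem_image]
      constructor
      · rintro ⟨y, hy, rfl⟩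
        exact (he y).2 hy
      · intro hx
        exact ⟨e.symm x, (he _).1 (by simpa using hx), by simp⟩)
  rw [hA, hmul] at h
  exact Relation.ReflTransGen.single h

end SOCSystem

/-- An isometry of `ℝ^m`, in coordinates, that sends two given orthonormal vectors to the first two
standard basis vectors. -/
theorem exists_linearEquiv_orthonormal_pair {m : ℕ} (p q : Fin m → ℝ) (hp : p ⬝ᵥ p = 1)
    (hq : q ⬝ᵥ q = 1) (hpq : p ⬝ᵥ q = 0) :
    ∃ hm : 2 ≤ m, ∃ O : (Fin m → ℝ) ≃ₗ[ℝ] (Fin m → ℝ), (∀ x, O x ⬝ᵥ O x = x ⬝ᵥ x) ∧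
      O p = Pi.single ⟨0, by omega⟩ 1 ∧ O q = Pi.single ⟨1, by omega⟩ 1 := by
  have hin : ∀ x y : Fin m → ℝ, inner ℝ (WithLp.toLp 2 x) (WithLp.toLp 2 y) = y ⬝ᵥ x := by
    intro x y
    rw [EuclideanSpace.inner_toLp_toLp, star_trivial]
  have hqp : q ⬝ᵥ p = 0 := by rw [dotProduct_comm, hpq]
  have hn : ∀ x : Fin m → ℝ, x ⬝ᵥ x = 1 → ‖WithLp.toLp 2 x‖ = 1 := fun x hx => by
    rw [norm_eq_sqrt_real_inner, hin, hx, Real.sqrt_one]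
  have hnp := hn p hp
  have hnq := hn q hq
  have hm : 2 ≤ m := by
    have hli : Orthonormal ℝ ![WithLp.toLp 2 p, WithLp.toLp 2 q] := by
      rw [orthonormal_iff_ite]
      intro i j
      fin_cases i <;> fin_cases j <;> simp [hin, hnp, hnq, hpq, hqp]
    simpa using hli.linearIndependent.fintype_card_le_finrank
  let i0 : Fin m := ⟨0, by omega⟩
  let i1 : Fin m := ⟨1, by omega⟩
  have h01 : i0 ≠ i1 := by simp [i0, i1]
  -- Only the values at `i0` and `i1` matter; the basis extension replaces all others.
  let v : Fin m → EuclideanSpace ℝ (Fin m) :=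
    fun k => if k = i0 then WithLp.toLp 2 p else WithLp.toLp 2 q
  have hv0 : v i0 = WithLp.toLp 2 p := by simp [v]
  have hv1 : v i1 = WithLp.toLp 2 q := by simp [v, h01.symm]
  have hv : Orthonormal ℝ (({i0, i1} : Set (Fin m)).domRestrict v) := by
    rw [orthonormal_iff_ite]
    rintro ⟨i, hi⟩ ⟨j, hj⟩
    simp only [Set.domRestrict_apply, Subtype.mk.injEq]
    rcases hi with hi | hi <;> rcases hj with hj | hj <;> rw [hi, hj] <;>
      simp only [hv0, hv1, hin, hp, hq, hpq, hqp, h01, h01.symm, if_true, if_false]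
  obtain ⟨B, hB⟩ := hv.exists_orthonormalBasis_extension_of_card_eq (by simp)
  refine ⟨hm, (WithLp.linearEquiv 2 ℝ (Fin m → ℝ)).symm ≪≫ₗ B.repr.toLinearEquiv ≪≫ₗ
    WithLp.linearEquiv 2 ℝ (Fin m → ℝ), ?_, ?_, ?_⟩
  · intro x
    rw [← hin, ← hin]
    exact B.repr.inner_map_map _ _
  · have : B.repr (WithLp.toLp 2 p) = EuclideanSpace.single i0 1 := by
      rw [← hv0, ← hB i0 (by simp), B.repr_self]
    show (B.repr (WithLp.toLp 2 p)).ofLp = _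
    rw [this]; rfl
  · have : B.repr (WithLp.toLp 2 q) = EuclideanSpace.single i1 1 := by
      rw [← hv1, ← hB i1 (by simp), B.repr_self]
    show (B.repr (WithLp.toLp 2 q)).ofLp = _
    rw [this]; rfl

/-! ### The Lorentz form and a single second order cone -/

/-- The Lorentz bilinear form on `ℝ^(d+1)`. -/
def lorentz {d : ℕ} (x y : Fin (d + 1) → ℝ) : ℝ :=
  x 0 * y 0 - ∑ k : Fin d, x k.succ * y k.succ

section Lorentz

variable {d : ℕ} {x y z v : Fin (d + 1) → ℝ}

theorem lorentz_self (x : Fin (d + 1) → ℝ) : lorentz x x = x 0 ^ 2 - ∑ k : Fin d, x k.succ ^ 2 := by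
  simp [lorentz, sq]

theorem lorentz_add_right (x y z : Fin (d + 1) → ℝ) :
    lorentz x (y + z) = lorentz x y + lorentz x z := by
  simp only [lorentz, Pi.add_apply, mul_add, Finset.sum_add_distrib]; ring

theorem lorentz_smul_right (a : ℝ) (x y : Fin (d + 1) → ℝ) :
    lorentz x (a • y) = a * lorentz x y := by
  simp only [lorentz, Pi.smul_apply, smul_eq_mul, mul_sub, Finset.mul_sum]
  congr 1
  · ring
  · exact Finset.sum_congr rfl fun _ _ => by ring

theorem lorentz_comm (x y : Fin (d + 1) → ℝ) : lorentz x y = lorentz y x := by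
  simp only [lorentz, mul_comm]

theorem lorentz_add_self (x y : Fin (d + 1) → ℝ) :
    lorentz (x + y) (x + y) = lorentz x x + 2 * lorentz x y + lorentz y y := by
  rw [lorentz_add_right, lorentz_comm (x + y) x, lorentz_comm (x + y) y, lorentz_add_right,
    lorentz_add_right, lorentz_comm y x]
  ring

theorem lorentz_smul_self (a : ℝ) (x : Fin (d + 1) → ℝ) :
    lorentz (a • x) (a • x) = a ^ 2 * lorentz x x := by
  rw [lorentz_smul_right, lorentz_comm, lorentz_smul_right]; ring

theorem mem_secondOrderCone_iff :
    x ∈ secondOrderCone d ↔ 0 ≤ x 0 ∧ 0 ≤ lorentz x x := by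
  rw [lorentz_self, sub_nonneg]
  exact Real.sqrt_le_iff

/-- Cauchy–Schwarz on the tails. The two signs give nonnegativity of the Lorentz product and of the
dot product on the cone. -/
theorem abs_sum_mul_le (hx : x ∈ secondOrderCone d) (hy : y ∈ secondOrderCone d) :
    |∑ k : Fin d, x k.succ * y k.succ| ≤ x 0 * y 0 := by
  rw [mem_secondOrderCone_iff, lorentz_self] at hx hy
  refine abs_le_of_sq_le_sq ?_ (mul_nonneg hx.1 hy.1)
  refine (Finset.sum_mul_sq_le_sq_mul_sq _ _ _).trans ?_
  rw [mul_pow]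
  exact mul_le_mul (by linarith) (by linarith) (Finset.sum_nonneg fun _ _ => sq_nonneg _)
    (sq_nonneg _)

theorem lorentz_nonneg (hx : x ∈ secondOrderCone d) (hy : y ∈ secondOrderCone d) :
    0 ≤ lorentz x y :=
  sub_nonneg.2 ((le_abs_self _).trans (abs_sum_mul_le hx hy))

theorem dotProduct_nonneg_of_mem_secondOrderCone (hx : x ∈ secondOrderCone d)
    (hy : y ∈ secondOrderCone d) : 0 ≤ x ⬝ᵥ y := by
  rw [dotProduct, Fin.sum_univ_succ]
  linarith [(abs_le.1 (abs_sum_mul_le hx hy)).1]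

theorem add_mem_secondOrderCone (hx : x ∈ secondOrderCone d) (hy : y ∈ secondOrderCone d) :
    x + y ∈ secondOrderCone d := by
  have h := lorentz_nonneg hx hy
  rw [mem_secondOrderCone_iff] at *
  rw [lorentz_add_self]
  exact ⟨add_nonneg hx.1 hy.1, by linarith⟩

theorem smul_mem_secondOrderCone {a : ℝ} (ha : 0 ≤ a) (hx : x ∈ secondOrderCone d) :
    a • x ∈ secondOrderCone d := by
  rw [mem_secondOrderCone_iff] at *
  rw [lorentz_smul_self]
  exact ⟨mul_nonneg ha hx.1, mul_nonneg (sq_nonneg _) hx.2⟩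

theorem abs_le_of_mem_secondOrderCone (hx : x ∈ secondOrderCone d) (k : Fin (d + 1)) :
    |x k| ≤ x 0 := by
  rw [mem_secondOrderCone_iff, lorentz_self] at hx
  refine Fin.cases (abs_of_nonneg hx.1).le (fun k => ?_) k
  refine abs_le_of_sq_le_sq ?_ hx.1
  have := Finset.single_le_sum (f := fun k : Fin d => x k.succ ^ 2) (fun _ _ => sq_nonneg _)
    (Finset.mem_univ k)
  linarith

theorem eq_zero_of_mem_secondOrderCone (hx : x ∈ secondOrderCone d) (h : x 0 ≤ 0) : x = 0 :=
  funext fun k => abs_nonpos_iff.1 ((abs_le_of_mem_secondOrderCone hx k).trans h)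

theorem zero_mem_secondOrderCone : (0 : Fin (d + 1) → ℝ) ∈ secondOrderCone d := by
  rw [mem_secondOrderCone_iff, lorentz_self]; simp

theorem isClosed_secondOrderCone (d : ℕ) : IsClosed (secondOrderCone d) :=
  isClosed_le (by fun_prop) (by fun_prop)

open Classical in
/-- The rank of a point of the second order cone: `0` at the origin, `1` at the other boundary
points, `2` in the interior. -/
noncomputable def lorentzRank {d : ℕ} (x : Fin (d + 1) → ℝ) : ℕ :=
  if 0 < x 0 then if 0 < lorentz x x then 2 else 1 else 0

theorem lorentzRank_le (x : Fin (d + 1) → ℝ) : lorentzRank x ≤ 2 := by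
  unfold lorentzRank; split_ifs <;> omega

theorem eventually_pos_add_smul (h : 0 < x 0) : ∀ᶠ ε : ℝ in 𝓝[>] 0, 0 < (x + ε • v) 0 := by
  have : Tendsto (fun ε : ℝ => (x + ε • v) 0) (𝓝 0) (𝓝 ((x + (0 : ℝ) • v) 0)) :=
    Continuous.tendsto (by simp only [Pi.add_apply, Pi.smul_apply]; fun_prop) 0
  rw [zero_smul, add_zero] at this
  exact nhdsWithin_le_nhds (this.eventually (lt_mem_nhds h))

theorem lorentz_add_smul_self (ε : ℝ) : lorentz (x + ε • v) (x + ε • v) =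
    lorentz x x + ε * (2 * lorentz x v + ε * lorentz v v) := by
  rw [lorentz_add_self, lorentz_smul_right, lorentz_smul_self]; ring

/-- Along the segment the Lorentz form is a quadratic polynomial in `ε` whose first nonvanishing
coefficient is positive. -/
theorem eventually_interior_add_smul (h0 : 0 < x 0) (h1 : 0 ≤ lorentz x x)
    (h : 0 < lorentz x x ∨ 0 < lorentz x v) :
    ∀ᶠ ε : ℝ in 𝓝[>] 0, 0 < (x + ε • v) 0 ∧ 0 < lorentz (x + ε • v) (x + ε • v) := by
  refine (eventually_pos_add_smul h0).and ?_
  rcases h with h | h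
  · have : Tendsto (fun ε : ℝ => lorentz x x + ε * (2 * lorentz x v + ε * lorentz v v)) (𝓝 0)
        (𝓝 (lorentz x x + 0 * (2 * lorentz x v + 0 * lorentz v v))) :=
      Continuous.tendsto (by fun_prop) 0
    rw [zero_mul, add_zero] at this
    filter_upwards [nhdsWithin_le_nhds (this.eventually (lt_mem_nhds h))] with ε hε
    rwa [lorentz_add_smul_self]
  · have : Tendsto (fun ε : ℝ => 2 * lorentz x v + ε * lorentz v v) (𝓝 0)
        (𝓝 (2 * lorentz x v + 0 * lorentz v v)) :=
      Continuous.tendsto (by fun_prop) 0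
    rw [zero_mul, add_zero] at this
    filter_upwards [nhdsWithin_le_nhds (this.eventually (lt_mem_nhds (mul_pos two_pos h))),
      self_mem_nhdsWithin] with ε hε hε0
    rw [lorentz_add_smul_self]
    have := mul_pos (Set.mem_Ioi.1 hε0) hε
    linarith

/-- An interior point of the second order cone is an order unit. -/
theorem exists_smul_add_mem_of_interior (h0 : 0 < z 0) (h1 : 0 < lorentz z z)
    (e : Fin (d + 1) → ℝ) : ∃ a : ℝ, 0 ≤ a ∧ ∀ a' ≥ a, a' • z + e ∈ secondOrderCone d := by
  obtain ⟨ε, ⟨h2, h3⟩, hε⟩ := ((eventually_interior_add_smul (v := e) h0 h1.le (.inl h1)).and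
    self_mem_nhdsWithin).exists
  replace hε : 0 < ε := hε
  have hz : z ∈ secondOrderCone d := mem_secondOrderCone_iff.2 ⟨h0.le, h1.le⟩
  have hze : z + ε • e ∈ secondOrderCone d := mem_secondOrderCone_iff.2 ⟨h2.le, h3.le⟩
  refine ⟨ε⁻¹, (inv_pos.2 hε).le, fun a' ha' => ?_⟩
  have : a' • z + e = (a' - ε⁻¹) • z + ε⁻¹ • (z + ε • e) := by
    rw [smul_add, smul_smul, inv_mul_cancel₀ hε.ne', one_smul, sub_smul]; abel
  rw [this]
  exact add_mem_secondOrderCone (smul_mem_secondOrderCone (sub_nonneg.2 ha') hz)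
    (smul_mem_secondOrderCone (inv_pos.2 hε).le hze)

theorem lorentzRank_eq_two (h0 : 0 < x 0) (h1 : 0 < lorentz x x) : lorentzRank x = 2 := by
  simp [lorentzRank, h0, h1]

theorem lorentzRank_pos (h0 : 0 < x 0) : 0 < lorentzRank x := by
  unfold lorentzRank; split_ifs <;> omega

theorem lorentzRank_le_one (h : ¬ 0 < lorentz x x) : lorentzRank x ≤ 1 := by
  unfold lorentzRank; split_ifs; all_goals omega

theorem lorentzRank_eq_zero (h : ¬ 0 < x 0) : lorentzRank x = 0 := by
  simp [lorentzRank, h]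

end Lorentz

/-! ### Duality with an order unit -/

/-- Strong duality under the Slater condition: if `z` is an order unit for the cone `C` and `c` is
bounded by `v` on `{u | z - M u ∈ C}`, then some functional in the dual of `C` certifies it. -/
theorem PointedCone.exists_dual_certificate {U E : Type*} [AddCommGroup U] [Module ℝ U]
    [AddCommGroup E] [Module ℝ E] (C : PointedCone ℝ E) (z : E)
    (hz : ∀ e, ∃ a : ℝ, 0 ≤ a ∧ a • z + e ∈ C) (M : U →ₗ[ℝ] E) (c : U →ₗ[ℝ] ℝ) (v : ℝ)
    (h : ∀ u, z - M u ∈ C → c u ≤ v) :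
    ∃ y : E →ₗ[ℝ] ℝ, (∀ e ∈ C, 0 ≤ y e) ∧ (∀ u, y (M u) = c u) ∧ y z ≤ v := by
  have hzC : z ∈ C := by
    obtain ⟨a, ha, h⟩ := hz z
    have h' := PointedCone.smul_mem C (show 0 ≤ (a + 1)⁻¹ by positivity) h
    have e : a • z + z = (a + 1) • z := by rw [add_smul, one_smul]
    rwa [e, smul_smul, inv_mul_cancel₀ (by positivity), one_smul] at h'
  -- Homogenize the constraint with a variable `α` and perturb it by `e`. The functional `v α - c u`
  -- on the subspace `e = 0` is extended by M. Riesz, and the multiplier is the restriction of the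
  -- extension to the perturbations.
  let s : PointedCone ℝ ((ℝ × U) × E) :=
    { carrier := {w | 0 ≤ w.1.1 ∧ w.1.1 • z - M w.1.2 + w.2 ∈ C}
      smul_mem' := by
        rintro ⟨a, ha⟩ ⟨⟨α, u⟩, e⟩ ⟨h1, h2⟩
        refine ⟨mul_nonneg ha h1, ?_⟩
        have := PointedCone.smul_mem C ha h2
        rw [smul_add, smul_sub, smul_smul, ← map_smul] at this
        exact this
      zero_mem' := ⟨le_rfl, by simp⟩
      add_mem' := by
        rintro ⟨⟨α, u⟩, e⟩ ⟨⟨α', u'⟩, e'⟩ ⟨h1, h2⟩ ⟨h1', h2'⟩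
        refine ⟨add_nonneg h1 h1', ?_⟩
        have := C.add_mem h2 h2'
        convert this using 1
        simp only [Prod.mk_add_mk, map_add, add_smul]
        abel }
  let f : ((ℝ × U) × E) →ₗ.[ℝ] ℝ :=
    { domain := LinearMap.ker (LinearMap.snd ℝ (ℝ × U) E)
      toFun := (v • LinearMap.fst ℝ ℝ U - c ∘ₗ LinearMap.snd ℝ ℝ U) ∘ₗ
        LinearMap.fst ℝ (ℝ × U) E ∘ₗ Submodule.subtype _ }
  have hf : ∀ x : f.domain, f x = v * (x : (ℝ × U) × E).1.1 - c (x : (ℝ × U) × E).1.2 :=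
    fun x => rfl
  obtain ⟨g, hg, hgs⟩ := riesz_extension s f (by
    rintro ⟨⟨⟨α, u⟩, e⟩, he⟩ ⟨h1, h2⟩
    obtain rfl : e = 0 := he
    rw [hf]
    simp only [add_zero] at h1 h2 ⊢
    -- If `α = 0`, then `z - t M u` stays in `C` for all `t > 0`, so `c u > 0` would make the
    -- objective unbounded. If `α > 0`, rescale to `α = 1`.
    rcases h1.eq_or_lt with rfl | h1
    · rw [zero_smul, zero_sub] at h2
      by_contra! hneg
      have hcu : 0 < c u := by linarith
      have h3 : ∀ t : ℝ, 0 < t → t * c u ≤ v := fun t ht => by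
        have := h (t • u) (by
          rw [map_smul, sub_eq_add_neg, ← smul_neg]
          exact C.add_mem hzC (PointedCone.smul_mem C ht.le h2))
        simpa using this
      have h4 := h3 ((|v| + 1) / c u) (by positivity)
      rw [div_mul_cancel₀ _ hcu.ne'] at h4
      linarith [le_abs_self v]
    · have := h (α⁻¹ • u) (by
        have := PointedCone.smul_mem C (inv_pos.2 h1).le h2
        rwa [smul_sub, smul_smul, inv_mul_cancel₀ h1.ne', one_smul, ← map_smul] at this)
      rw [map_smul, smul_eq_mul, inv_mul_le_iff₀ h1] at this
      linarith) (by
    rintro ⟨⟨α, u⟩, e⟩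
    obtain ⟨a, ha, hmem⟩ := hz (-M u + e)
    refine ⟨⟨((a - α, 0), 0), rfl⟩, ?_⟩
    show 0 ≤ a - α + α ∧ (a - α + α) • z - M (0 + u) + (0 + e) ∈ C
    rw [sub_add_cancel, zero_add, zero_add, sub_eq_add_neg, add_assoc]
    exact ⟨ha, hmem⟩)
  have hg0 : ∀ α u, g ((α, u), 0) = v * α - c u := fun α u => hg ⟨((α, u), 0), rfl⟩
  refine ⟨g ∘ₗ LinearMap.inr ℝ (ℝ × U) E, fun e he => hgs _ ⟨le_rfl, by simpa using he⟩,
    fun u => ?_, ?_⟩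
  -- The perturbation `M u` cancels the constraint exactly, so both signs of `u` are allowed and the
  -- inequality becomes an equality.
  · have key : ∀ u, g ((0, 0), M u) - c u ≥ 0 := fun u => by
      have h1 := hgs ((0, u), M u) ⟨le_rfl, by simp⟩
      have h2 : (((0 : ℝ), u), M u) = ((0, u), 0) + ((0, 0), M u) := by simp
      rw [h2, map_add, hg0] at h1
      linarith
    have h1 := key u
    have h2 := key (-u)
    have h3 : (((0 : ℝ), (0 : U)), -M u) = -((0, 0), M u) := by simp
    rw [map_neg, map_neg, h3, map_neg] at h2
    show g ((0, 0), M u) = c u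
    linarith
  · have h1 := hgs ((1, 0), -z) ⟨zero_le_one, by simp⟩
    have h2 : (((1 : ℝ), (0 : U)), -z) = ((1, 0), 0) - ((0, 0), z) := by simp
    rw [h2, map_sub, hg0, map_zero] at h1
    show g ((0, 0), z) ≤ v
    linarith

/-! ### The product cone: compact base and nonnegative extension -/

section Prod

variable {t : ℕ} {d : Fin t → ℕ} {x y : (Σ i : Fin t, Fin (d i + 1)) → ℝ}

/-- The block with index `i` of a vector, as a linear map. -/
def blockMap (d : Fin t → ℕ) (i : Fin t) :
    ((Σ i : Fin t, Fin (d i + 1)) → ℝ) →ₗ[ℝ] (Fin (d i + 1) → ℝ) :=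
  LinearMap.funLeft ℝ ℝ (fun k => ⟨i, k⟩)

theorem mem_prodSecondOrderCone_iff :
    x ∈ prodSecondOrderCone d ↔ ∀ i, blockMap d i x ∈ secondOrderCone (d i) := Iff.rfl

theorem blockMap_ext (h : ∀ i, blockMap d i x = blockMap d i y) : x = y :=
  funext fun r => congrFun (h r.1) r.2

theorem add_mem_prodSecondOrderCone (hx : x ∈ prodSecondOrderCone d)
    (hy : y ∈ prodSecondOrderCone d) : x + y ∈ prodSecondOrderCone d := fun i =>
  add_mem_secondOrderCone (hx i) (hy i)

theorem smul_mem_prodSecondOrderCone {a : ℝ} (ha : 0 ≤ a) (hx : x ∈ prodSecondOrderCone d) :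
    a • x ∈ prodSecondOrderCone d := fun i => smul_mem_secondOrderCone ha (hx i)

/-- Every coordinate of a cone point is bounded by the first one of its block, so this slice is
bounded. It is the compact set that Hahn–Banach separates from a subspace. -/
theorem isCompact_base_prodSecondOrderCone (d : Fin t → ℕ) :
    IsCompact {x | x ∈ prodSecondOrderCone d ∧ ∑ i, x ⟨i, 0⟩ = 1} := by
  apply Metric.isCompact_of_isClosed_isBounded
  · refine IsClosed.inter ?_ (isClosed_eq (by fun_prop) continuous_const)
    have : prodSecondOrderCone d = ⋂ i, blockMap d i ⁻¹' secondOrderCone (d i) := by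
      ext x; simp [mem_prodSecondOrderCone_iff]
    change IsClosed (prodSecondOrderCone d)
    rw [this]
    exact isClosed_iInter fun i => (isClosed_secondOrderCone _).preimage
      (LinearMap.continuous_of_finiteDimensional _)
  · refine (Metric.isBounded_closedBall (x := 0) (r := 1)).subset ?_
    rintro x ⟨hx, h1⟩
    rw [mem_closedBall_zero_iff, pi_norm_le_iff_of_nonneg zero_le_one]
    rintro ⟨i, k⟩
    rw [Real.norm_eq_abs]
    refine (abs_le_of_mem_secondOrderCone (hx i) k).trans ?_
    rw [← h1]
    exact Finset.single_le_sum (f := fun i => x ⟨i, 0⟩)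
      (fun i _ => (mem_secondOrderCone_iff.1 (hx i)).1) (Finset.mem_univ i)

/-- A functional on a subspace that meets the cone only at the origin agrees there with a functional
that is nonnegative on the cone. -/
theorem exists_nonneg_extension (L : Submodule ℝ ((Σ i : Fin t, Fin (d i + 1)) → ℝ))
    (hL : ∀ x ∈ L, x ∈ prodSecondOrderCone d → x = 0)
    (p : ((Σ i : Fin t, Fin (d i + 1)) → ℝ) →ₗ[ℝ] ℝ) :
    ∃ p' : ((Σ i : Fin t, Fin (d i + 1)) → ℝ) →ₗ[ℝ] ℝ, (∀ x ∈ L, p' x = p x) ∧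
      ∀ x ∈ prodSecondOrderCone d, 0 ≤ p' x := by
  have hB := isCompact_base_prodSecondOrderCone d
  set B := {x | x ∈ prodSecondOrderCone d ∧ ∑ i, x ⟨i, 0⟩ = 1} with hBdef
  have hconv : Convex ℝ B := by
    rintro x ⟨hx, hx1⟩ y ⟨hy, hy1⟩ a b ha hb hab
    refine ⟨add_mem_prodSecondOrderCone (smul_mem_prodSecondOrderCone ha hx)
      (smul_mem_prodSecondOrderCone hb hy), ?_⟩
    simp only [Pi.add_apply, Pi.smul_apply, smul_eq_mul, Finset.sum_add_distrib,
      ← Finset.mul_sum, hx1, hy1, mul_one, hab]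
  have hdisj : Disjoint B (L : Set ((Σ i : Fin t, Fin (d i + 1)) → ℝ)) := by
    rw [Set.disjoint_left]
    rintro x ⟨hx, hx1⟩ hxL
    rw [hL x hxL hx] at hx1
    simp at hx1
  obtain ⟨f, a, b, hfa, hab, hfb⟩ := geometric_hahn_banach_compact_closed hconv hB L.convex
    L.closed_of_finiteDimensional hdisj
  have hb : b < 0 := by simpa using hfb 0 L.zero_mem
  have hf0 : ∀ x ∈ L, f x = 0 := fun x hx => by
    by_contra hne
    have := hfb ((b / f x) • x) (L.smul_mem _ hx)
    rw [map_smul, smul_eq_mul, div_mul_cancel₀ _ hne] at this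
    exact lt_irrefl _ this
  obtain ⟨m, hm⟩ := hB.exists_bound_of_continuousOn
    (LinearMap.continuous_of_finiteDimensional p).continuousOn
  have ha : 0 < -a := by linarith
  -- The separating `f` vanishes on `L` and is below `a < 0` on the base, where `m` bounds `|p|`.
  -- This multiple of `-f` therefore outweighs `p` on the base and changes nothing on `L`.
  refine ⟨p - (|m| / -a) • (f : ((Σ i : Fin t, Fin (d i + 1)) → ℝ) →ₗ[ℝ] ℝ), fun x hx => ?_,
    fun x hx => ?_⟩
  · simp [hf0 x hx]
  · have hpos : ∀ x ∈ B, 0 ≤ p x - (|m| / -a) * f x := fun x hx => by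
      have h1 := (abs_le.1 (hm x hx)).1
      have h2 : |m| / -a * -a ≤ |m| / -a * -f x :=
        mul_le_mul_of_nonneg_left (by linarith [hfa x hx]) (by positivity)
      rw [div_mul_cancel₀ _ ha.ne'] at h2
      linarith [le_abs_self m]
    have hnn : ∀ i ∈ Finset.univ, 0 ≤ x ⟨i, 0⟩ := fun i _ => (mem_secondOrderCone_iff.1 (hx i)).1
    show 0 ≤ p x - (|m| / -a) * f x
    rcases (Finset.sum_nonneg hnn).eq_or_lt with h | h
    · have hx0 : x = 0 := blockMap_ext fun i => by
        rw [map_zero]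
        exact eq_zero_of_mem_secondOrderCone (hx i)
          ((Finset.sum_eq_zero_iff_of_nonneg hnn).1 h.symm i (Finset.mem_univ i)).le
      simp [hx0]
    · have h1 := hpos ((∑ i, x ⟨i, 0⟩)⁻¹ • x) ⟨smul_mem_prodSecondOrderCone (inv_pos.2 h).le hx, by
        simp only [Pi.smul_apply, smul_eq_mul, ← Finset.mul_sum]
        exact inv_mul_cancel₀ h.ne'⟩
      simp only [map_smul, smul_eq_mul] at h1
      have h2 := mul_nonneg h.le h1
      rw [mul_sub, mul_left_comm _ (|m| / -a), mul_inv_cancel_left₀ h.ne',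
        mul_inv_cancel_left₀ h.ne'] at h2
      exact h2

end Prod

/-! ### Collapsing a block at a point of the cone -/

section Collapse

variable {d : ℕ} {z w : Fin (d + 1) → ℝ}

/-- The functional `lorentz z`, as a linear map. -/
def lorentzMap (z : Fin (d + 1) → ℝ) : (Fin (d + 1) → ℝ) →ₗ[ℝ] ℝ where
  toFun := lorentz z
  map_add' := lorentz_add_right z
  map_smul' a x := lorentz_smul_right a z x

open Classical in
/-- A linear map that sends the second order cone to a pointed cone, and whose kernel is the
lineality space of the closure of the cone of feasible directions at `z`. -/
noncomputable def collapse (z : Fin (d + 1) → ℝ) : (Fin (d + 1) → ℝ) →ₗ[ℝ] (Fin (d + 1) → ℝ) :=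
  if 0 < z 0 then
    if 0 < lorentz z z then 0 else (lorentzMap z).smulRight (Pi.single 0 1)
  else LinearMap.id

theorem collapse_vertex (h : ¬ 0 < z 0) : collapse z w = w := by simp [collapse, h]

theorem collapse_interior (h0 : 0 < z 0) (h : 0 < lorentz z z) : collapse z w = 0 := by
  simp [collapse, h0, h]

theorem collapse_boundary (h0 : 0 < z 0) (h : lorentz z z = 0) :
    collapse z w = lorentz z w • Pi.single 0 1 := by
  simp [collapse, h0, h, lorentzMap]

theorem secondOrderCone_cases (hz : z ∈ secondOrderCone d) :
    (¬ 0 < z 0 ∧ z = 0) ∨ (0 < z 0 ∧ 0 < lorentz z z) ∨ (0 < z 0 ∧ lorentz z z = 0) := by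
  by_cases h0 : 0 < z 0
  · rcases (mem_secondOrderCone_iff.1 hz).2.eq_or_lt with h | h
    · exact .inr (.inr ⟨h0, h.symm⟩)
    · exact .inr (.inl ⟨h0, h⟩)
  · exact .inl ⟨h0, eq_zero_of_mem_secondOrderCone hz (not_lt.1 h0)⟩

theorem smul_single_mem_secondOrderCone_iff {a : ℝ} :
    a • (Pi.single 0 1 : Fin (d + 1) → ℝ) ∈ secondOrderCone d ↔ 0 ≤ a := by
  rw [mem_secondOrderCone_iff, lorentz_smul_self, lorentz_self]
  simp [sq_nonneg]

theorem collapse_mem (hz : z ∈ secondOrderCone d) (hw : w ∈ secondOrderCone d) :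
    collapse z w ∈ secondOrderCone d := by
  rcases secondOrderCone_cases hz with ⟨h0, -⟩ | ⟨h0, h⟩ | ⟨h0, h⟩
  · rwa [collapse_vertex h0]
  · rw [collapse_interior h0 h]
    exact zero_mem_secondOrderCone
  · rw [collapse_boundary h0 h, smul_single_mem_secondOrderCone_iff]
    exact lorentz_nonneg hz hw

theorem collapse_self (hz : z ∈ secondOrderCone d) : collapse z z = 0 := by
  rcases secondOrderCone_cases hz with ⟨h0, rfl⟩ | ⟨h0, h⟩ | ⟨h0, h⟩
  · exact map_zero _
  · exact collapse_interior h0 h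
  · rw [collapse_boundary h0 h, h, zero_smul]

/-- At the origin any nonzero cone direction raises the rank; in the interior small moves are
harmless. At another boundary point a positive Lorentz product leads into the interior, while a
tangent direction is parallel to `z` by `hpar`, so the move stays on the ray. -/
theorem eventually_mem_and_lorentzRank_le (hz : z ∈ secondOrderCone d)
    (hw : collapse z w ∈ secondOrderCone d)
    (hpar : 0 < z 0 → lorentz z z = 0 → lorentz z w = 0 → ∃ a : ℝ, w = a • z) :
    ∀ᶠ ε : ℝ in 𝓝[>] 0, z + ε • w ∈ secondOrderCone d ∧ lorentzRank z ≤ lorentzRank (z + ε • w) ∧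
      (lorentzRank (z + ε • w) ≤ lorentzRank z → collapse z w = 0) := by
  rcases secondOrderCone_cases hz with ⟨h0, rfl⟩ | ⟨h0, h⟩ | ⟨h0, h⟩
  · rw [collapse_vertex h0] at hw ⊢
    filter_upwards [self_mem_nhdsWithin] with ε hε
    replace hε : 0 < ε := hε
    rw [lorentzRank_eq_zero h0, zero_add]
    refine ⟨smul_mem_secondOrderCone hε.le hw, Nat.zero_le _, fun hr => ?_⟩
    by_contra hne
    have hw0 : 0 < w 0 := not_le.1 fun hle => hne (eq_zero_of_mem_secondOrderCone hw hle)
    have : 0 < lorentzRank (ε • w) := lorentzRank_pos (mul_pos hε hw0)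
    omega
  · filter_upwards [eventually_interior_add_smul (v := w) h0 h.le (.inl h)] with ε hε
    rw [collapse_interior h0 h, lorentzRank_eq_two hε.1 hε.2]
    exact ⟨mem_secondOrderCone_iff.2 ⟨hε.1.le, hε.2.le⟩, lorentzRank_le _, fun _ => rfl⟩
  · rw [collapse_boundary h0 h, smul_single_mem_secondOrderCone_iff] at hw
    have hle : lorentzRank z ≤ 1 := lorentzRank_le_one (by rw [h]; exact lt_irrefl _)
    rcases hw.eq_or_lt with hw | hw
    · obtain ⟨a, ha⟩ := hpar h0 h hw.symm
      filter_upwards [eventually_pos_add_smul (v := w) h0] with ε hε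
      refine ⟨mem_secondOrderCone_iff.2 ⟨hε.le, ?_⟩, hle.trans (lorentzRank_pos hε), fun _ => ?_⟩
      · rw [lorentz_add_smul_self, ← hw, ha, lorentz_smul_self, h]
        simp
      · rw [collapse_boundary h0 h, ← hw, zero_smul]
    · filter_upwards [eventually_interior_add_smul (v := w) h0 h.ge (.inr hw)] with ε hε
      rw [lorentzRank_eq_two hε.1 hε.2]
      exact ⟨mem_secondOrderCone_iff.2 ⟨hε.1.le, hε.2.le⟩, lorentzRank_le _,
        fun hr => absurd hr (by omega)⟩

end Collapse

/-! ### A sufficient condition for good behaviour -/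

section Prod

variable {t : ℕ} {d : Fin t → ℕ} {z : (Σ i : Fin t, Fin (d i + 1)) → ℝ}

/-- The blockwise map `collapse`. -/
noncomputable def collapseProd (z : (Σ i : Fin t, Fin (d i + 1)) → ℝ) :
    ((Σ i : Fin t, Fin (d i + 1)) → ℝ) →ₗ[ℝ] ((Σ i : Fin t, Fin (d i + 1)) → ℝ) :=
  LinearMap.pi fun r => LinearMap.proj r.2 ∘ₗ collapse (blockMap d r.1 z) ∘ₗ blockMap d r.1

theorem blockMap_collapseProd (i : Fin t) (e : (Σ i : Fin t, Fin (d i + 1)) → ℝ) :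
    blockMap d i (collapseProd z e) = collapse (blockMap d i z) (blockMap d i e) := rfl

/-- A relaxation of the product cone for which `z` is an order unit: blocks where `z` vanishes are
unconstrained, and the cone is replaced by a half-space where `z` is a nonzero boundary point. -/
def relaxedCone (z : (Σ i : Fin t, Fin (d i + 1)) → ℝ) :
    PointedCone ℝ ((Σ i : Fin t, Fin (d i + 1)) → ℝ) where
  carrier := {e | ∀ i, 0 < z ⟨i, 0⟩ →
    (0 < lorentz (blockMap d i z) (blockMap d i z) → blockMap d i e ∈ secondOrderCone (d i)) ∧
    (lorentz (blockMap d i z) (blockMap d i z) = 0 → 0 ≤ blockMap d i z ⬝ᵥ blockMap d i e)}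
  add_mem' := by
    intro x y hx hy i hi
    refine ⟨fun h => ?_, fun h => ?_⟩
    · rw [map_add]
      exact add_mem_secondOrderCone ((hx i hi).1 h) ((hy i hi).1 h)
    · rw [map_add, dotProduct_add]
      exact add_nonneg ((hx i hi).2 h) ((hy i hi).2 h)
  zero_mem' := by
    intro i _
    rw [map_zero, dotProduct_zero]
    exact ⟨fun _ => zero_mem_secondOrderCone, fun _ => le_rfl⟩
  smul_mem' := by
    rintro ⟨a, ha⟩ x hx i hi
    refine ⟨fun h => smul_mem_secondOrderCone ha ((hx i hi).1 h), fun h => ?_⟩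
    have : blockMap d i z ⬝ᵥ blockMap d i (a • x) = a * (blockMap d i z ⬝ᵥ blockMap d i x) := by
      rw [map_smul, dotProduct_smul, smul_eq_mul]
    exact this ▸ mul_nonneg ha ((hx i hi).2 h)

theorem mem_relaxedCone {e : (Σ i : Fin t, Fin (d i + 1)) → ℝ} :
    e ∈ relaxedCone z ↔ ∀ i, 0 < z ⟨i, 0⟩ →
    (0 < lorentz (blockMap d i z) (blockMap d i z) → blockMap d i e ∈ secondOrderCone (d i)) ∧
    (lorentz (blockMap d i z) (blockMap d i z) = 0 → 0 ≤ blockMap d i z ⬝ᵥ blockMap d i e) :=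
  Iff.rfl

theorem mem_relaxedCone_of_mem (hz : z ∈ prodSecondOrderCone d)
    {e : (Σ i : Fin t, Fin (d i + 1)) → ℝ} (he : e ∈ prodSecondOrderCone d) :
    e ∈ relaxedCone z := fun i _ =>
  ⟨fun _ => he i, fun _ => dotProduct_nonneg_of_mem_secondOrderCone (hz i) (he i)⟩

/-- Each block has a threshold beyond which all multiples of `z` work: interior points are order
units, and in a half-space block `z ⬝ᵥ z > 0` dominates. The sum of the thresholds exceeds each of
them. -/
theorem exists_smul_add_mem_relaxedCone (e : (Σ i : Fin t, Fin (d i + 1)) → ℝ) :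
    ∃ a : ℝ, 0 ≤ a ∧ a • z + e ∈ relaxedCone z := by
  have key : ∀ i, ∃ a : ℝ, 0 ≤ a ∧ ∀ a' ≥ a, 0 < z ⟨i, 0⟩ →
      (0 < lorentz (blockMap d i z) (blockMap d i z) →
        a' • blockMap d i z + blockMap d i e ∈ secondOrderCone (d i)) ∧
      (lorentz (blockMap d i z) (blockMap d i z) = 0 →
        0 ≤ blockMap d i z ⬝ᵥ (a' • blockMap d i z + blockMap d i e)) := by
    intro i
    by_cases h0 : 0 < z ⟨i, 0⟩
    · by_cases h : 0 < lorentz (blockMap d i z) (blockMap d i z)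
      · obtain ⟨a, ha, hmem⟩ := exists_smul_add_mem_of_interior (z := blockMap d i z) h0 h
          (blockMap d i e)
        exact ⟨a, ha, fun a' ha' _ => ⟨fun _ => hmem a' ha', fun h' => absurd h' h.ne'⟩⟩
      · have hpos : 0 < blockMap d i z ⬝ᵥ blockMap d i z := by
          have h1 : 0 ≤ blockMap d i z ⬝ᵥ blockMap d i z :=
            Finset.sum_nonneg fun k _ => mul_self_nonneg _
          refine h1.lt_of_ne fun h2 => h0.ne' ?_
          exact congrFun (dotProduct_self_eq_zero.1 h2.symm) 0
        refine ⟨|blockMap d i z ⬝ᵥ blockMap d i e| / (blockMap d i z ⬝ᵥ blockMap d i z),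
          by positivity, fun a' ha' _ => ⟨fun h' => absurd h' h, fun _ => ?_⟩⟩
        rw [dotProduct_add, dotProduct_smul, smul_eq_mul]
        rw [ge_iff_le, div_le_iff₀ hpos] at ha'
        linarith [neg_abs_le (blockMap d i z ⬝ᵥ blockMap d i e)]
    · exact ⟨0, le_rfl, fun _ _ h => absurd h h0⟩
  choose a ha hmem using key
  refine ⟨∑ i, a i, Finset.sum_nonneg fun i _ => ha i, mem_relaxedCone.2 fun i hi => ?_⟩
  rw [map_add, map_smul]
  exact hmem i _ (Finset.single_le_sum (fun i _ => ha i) (Finset.mem_univ i)) hi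

/-- Some slack of a feasible conic system maximizes the sum of the ranks of the blocks. -/
theorem exists_max_lorentzRank {n : ℕ} {A : Matrix (Σ i : Fin t, Fin (d i + 1)) (Fin n) ℝ}
    {b : (Σ i : Fin t, Fin (d i + 1)) → ℝ}
    (h : (conicFeasible (prodSecondOrderCone d) A b).Nonempty) :
    ∃ x ∈ conicFeasible (prodSecondOrderCone d) A b,
      ∀ x' ∈ conicFeasible (prodSecondOrderCone d) A b,
        ∑ i, lorentzRank (blockMap d i (b - A *ᵥ x')) ≤
          ∑ i, lorentzRank (blockMap d i (b - A *ᵥ x)) := by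
  let R : (Fin n → ℝ) → ℕ := fun x => ∑ i, lorentzRank (blockMap d i (b - A *ᵥ x))
  have hR : ∀ x, R x ≤ t * 2 := fun x => by
    refine (Finset.sum_le_card_nsmul _ _ 2 fun i _ => lorentzRank_le _).trans ?_
    simp
  obtain ⟨x, hx, hmin⟩ := (measure fun x => t * 2 - R x).wf.has_min _ h
  refine ⟨x, hx, fun x' hx' => ?_⟩
  have h1 : ¬ t * 2 - R x' < t * 2 - R x := hmin x' hx'
  have h2 := hR x
  have h3 := hR x'
  change R x' ≤ R x
  omega

set_option maxHeartbeats 1600000 in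
/-- If no boundary block of a slack admits a tangent direction in the range of `A` other than the
multiples of the block itself, then the system is well-behaved. -/
theorem conicWellBehaved_of_tangent_eq_smul {n : ℕ}
    {A : Matrix (Σ i : Fin t, Fin (d i + 1)) (Fin n) ℝ}
    {b : (Σ i : Fin t, Fin (d i + 1)) → ℝ}
    (H : ∀ x, b - A *ᵥ x ∈ prodSecondOrderCone d → ∀ i,
      0 < blockMap d i (b - A *ᵥ x) 0 →
      lorentz (blockMap d i (b - A *ᵥ x)) (blockMap d i (b - A *ᵥ x)) = 0 →
      ∀ u, lorentz (blockMap d i (b - A *ᵥ x)) (blockMap d i (A *ᵥ u)) = 0 →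
        ∃ a : ℝ, blockMap d i (A *ᵥ u) = a • blockMap d i (b - A *ᵥ x)) :
    ConicWellBehaved (prodSecondOrderCone d) A b := by
  intro c v hv
  have hne : (conicFeasible (prodSecondOrderCone d) A b).Nonempty := by
    by_contra hempty
    rw [Set.not_nonempty_iff_eq_empty] at hempty
    rw [hempty, Set.image_empty, isLUB_empty_iff] at hv
    exact absurd (hv (v - 1)) (by simp)
  obtain ⟨x₀, hx₀, hmax⟩ := exists_max_lorentzRank hne
  specialize H x₀ hx₀
  obtain ⟨z, hz⟩ : ∃ z, z = b - A *ᵥ x₀ := ⟨_, rfl⟩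
  have hzK : z ∈ prodSecondOrderCone d := hz ▸ hx₀
  have hsub : ∀ u, b - A *ᵥ (x₀ + u) = z - A *ᵥ u := fun u => by
    rw [Matrix.mulVec_add, hz]; abel
  rw [← hz] at H hmax
  let φ := collapseProd z ∘ₗ A.mulVecLin
  have hφ : ∀ u i, blockMap d i (φ u) = collapse (blockMap d i z) (blockMap d i (A *ᵥ u)) :=
    fun u i => rfl
  -- Maximality of the rank enters here: a small feasible step lowers no block's rank, so it raises
  -- none, and every collapsed block is zero.
  have hrange : ∀ x ∈ LinearMap.range φ, x ∈ prodSecondOrderCone d → x = 0 := by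
    rintro _ ⟨u, rfl⟩ hu
    obtain ⟨ε, hε⟩ := (eventually_all.2 fun i => eventually_mem_and_lorentzRank_le (hzK i)
      (w := blockMap d i (A *ᵥ u)) (hu i) fun h0 h1 => H i h0 h1 u).exists
    have hslack : b - A *ᵥ (x₀ + (-ε) • u) = z + ε • A *ᵥ u := by
      rw [hsub, Matrix.mulVec_smul, neg_smul, sub_neg_eq_add]
    have hle := hmax (x₀ + (-ε) • u) (by
      show _ ∈ prodSecondOrderCone d
      rw [hslack]
      exact fun i => (hε i).1)
    rw [hslack] at hle
    have heq := (Finset.sum_eq_sum_iff_of_le fun i _ => (hε i).2.1).1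
      ((Finset.sum_le_sum fun i _ => (hε i).2.1).antisymm hle)
    exact blockMap_ext fun i => by
      rw [map_zero]
      exact (hε i).2.2 (heq i (Finset.mem_univ i)).ge
  let cl := dotProductEquiv ℝ (Fin n) c
  have hcl : ∀ u, cl u = c ⬝ᵥ u := fun u => rfl
  obtain ⟨y, hyC, hyA, hyz⟩ := (relaxedCone z).exists_dual_certificate z
    exists_smul_add_mem_relaxedCone (A.mulVecLin ∘ₗ (LinearMap.ker φ).subtype)
    (cl ∘ₗ (LinearMap.ker φ).subtype) (v - c ⬝ᵥ x₀) (by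
      rintro ⟨u, hu⟩ hmem
      replace hmem : z - A *ᵥ u ∈ relaxedCone z := hmem
      have hu0 : ∀ i, collapse (blockMap d i z) (blockMap d i (A *ᵥ u)) = 0 := fun i => by
        rw [← hφ, LinearMap.mem_ker.1 hu, map_zero]
      have hfeas : z - A *ᵥ u ∈ prodSecondOrderCone d := fun i => by
        change blockMap d i (z - A *ᵥ u) ∈ _
        have hi := hu0 i
        -- On the kernel of `φ` the relaxation is exact. A vanishing block of `z` does not move; in
        -- a boundary block `A u` is `a • z` by `H`, and the half-space condition says `1 - a ≥ 0`.
        rcases secondOrderCone_cases (hzK i) with ⟨h0, h⟩ | ⟨h0, h⟩ | ⟨h0, h⟩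
        · have h0' : ¬ 0 < blockMap d i z 0 := h0
          rw [collapse_vertex h0'] at hi
          rw [map_sub, hi, sub_zero]
          exact hzK i
        · exact (mem_relaxedCone.1 hmem i h0).1 h
        · have h0' : 0 < blockMap d i z 0 := h0
          have h' : lorentz (blockMap d i z) (blockMap d i z) = 0 := h
          rw [collapse_boundary h0' h'] at hi
          have hl := congrFun hi 0
          simp only [Pi.smul_apply, Pi.single_eq_same, smul_eq_mul, mul_one, Pi.zero_apply] at hl
          obtain ⟨a, ha⟩ := H i h0 h u hl
          have hm := (mem_relaxedCone.1 hmem i h0).2 h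
          rw [map_sub, ha] at hm ⊢
          have e : blockMap d i z - a • blockMap d i z = (1 - a) • blockMap d i z := by
            rw [sub_smul, one_smul]
          rw [e] at hm ⊢
          rw [dotProduct_smul, smul_eq_mul] at hm
          have hpos : 0 < blockMap d i z ⬝ᵥ blockMap d i z := by
            refine (Finset.sum_nonneg fun k _ => mul_self_nonneg _).lt_of_ne fun h2 => h0'.ne' ?_
            exact congrFun (dotProduct_self_eq_zero.1 h2.symm) 0
          exact smul_mem_secondOrderCone (nonneg_of_mul_nonneg_left hm hpos) (hzK i)
      have := hv.1 ⟨x₀ + u, show _ ∈ prodSecondOrderCone d from (hsub u).symm ▸ hfeas, rfl⟩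
      simp only [dotProduct_add] at this
      show c ⬝ᵥ u ≤ _
      linarith)
  -- The error of `y` vanishes on the kernel of `φ`, hence equals `p ∘ φ` for some `p`; only the
  -- values of `p` on the range of `φ` matter, so it may be replaced by `p'`.
  have hann : cl - y ∘ₗ A.mulVecLin ∈ (LinearMap.ker φ).dualAnnihilator := by
    rw [Submodule.mem_dualAnnihilator]
    intro u hu
    exact sub_eq_zero.2 (hyA ⟨u, hu⟩).symm
  rw [← LinearMap.range_dualMap_eq_dualAnnihilator_ker] at hann
  obtain ⟨p, hp⟩ := hann
  obtain ⟨p', hp'L, hp'K⟩ := exists_nonneg_extension (LinearMap.range φ) hrange p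
  let Y := y + p' ∘ₗ collapseProd z
  have hYK : ∀ x ∈ prodSecondOrderCone d, 0 ≤ Y x := fun x hx =>
    add_nonneg (hyC x (mem_relaxedCone_of_mem hzK hx))
      (hp'K _ fun i => collapse_mem (hzK i) (hx i))
  have hYA : ∀ u, Y (A *ᵥ u) = c ⬝ᵥ u := fun u => by
    have h1 : p' (φ u) = p (φ u) := hp'L _ ⟨u, rfl⟩
    have h2 : p (φ u) = c ⬝ᵥ u - y (A *ᵥ u) := LinearMap.congr_fun hp u
    show y (A *ᵥ u) + p' (φ u) = _
    rw [h1, h2]; ring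
  have hYz : Y z ≤ v - c ⬝ᵥ x₀ := by
    have : collapseProd z z = 0 := blockMap_ext fun i => by
      rw [blockMap_collapseProd, map_zero]
      exact collapse_self (hzK i)
    show y z + p' (collapseProd z z) ≤ _
    rwa [this, map_zero, add_zero]
  obtain ⟨w, hw⟩ := (dotProductEquiv ℝ (Σ i : Fin t, Fin (d i + 1))).surjective Y
  have hwY : ∀ x, w ⬝ᵥ x = Y x := fun x => LinearMap.congr_fun hw x
  refine ⟨w, fun x hx => hwY x ▸ hYK x hx, ?_, ?_⟩
  · refine dotProduct_eq _ _ fun u => ?_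
    rw [Matrix.mulVec_transpose, ← Matrix.dotProduct_mulVec, hwY, hYA]
  · rw [dotProduct_comm, hwY]
    have hb : b = z + A *ᵥ x₀ := by rw [hz]; abel
    -- The reverse inequality is weak duality: `Y` is nonnegative on every slack.
    refine le_antisymm ?_ (hv.2 ?_)
    · rw [hb, map_add, hYA]
      linarith
    · rintro _ ⟨x, hx, rfl⟩
      have h1 := hYK _ hx
      rw [map_sub, hYA] at h1
      show c ⬝ᵥ x ≤ _
      linarith

end Prod

/-! ### Rotation to normal form -/

/-- The linear map that acts on every block by the scaling `s`, composed with `O` on the coordinates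
other than the first. -/
def blockRotation {t m : ℕ} (s : ℝ) (O : (Fin m → ℝ) →ₗ[ℝ] (Fin m → ℝ)) :
    ((Σ _ : Fin t, Fin (m + 1)) → ℝ) →ₗ[ℝ] ((Σ _ : Fin t, Fin (m + 1)) → ℝ) where
  toFun x r := s * (Fin.cons (x ⟨r.1, 0⟩) (O fun k => x ⟨r.1, k.succ⟩) : Fin (m + 1) → ℝ) r.2
  map_add' x y := by
    funext ⟨i, k⟩
    refine Fin.cases ?_ (fun k => ?_) k
    · simp [mul_add]
    · have h := congrFun (O.map_add (fun k => x ⟨i, k.succ⟩) (fun k => y ⟨i, k.succ⟩)) k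
      exact (congrArg (s * ·) h).trans (mul_add _ _ _)
  map_smul' a x := by
    funext ⟨i, k⟩
    refine Fin.cases ?_ (fun k => ?_) k
    · simp [mul_left_comm]
    · have h := congrFun (O.map_smul a (fun k => x ⟨i, k.succ⟩)) k
      exact (congrArg (s * ·) h).trans (mul_left_comm _ _ _)

theorem blockRotation_zero {t m : ℕ} (s : ℝ) (O : (Fin m → ℝ) →ₗ[ℝ] (Fin m → ℝ))
    (x : (Σ _ : Fin t, Fin (m + 1)) → ℝ) (i : Fin t) :
    blockRotation s O x ⟨i, 0⟩ = s * x ⟨i, 0⟩ := rfl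

theorem blockRotation_succ {t m : ℕ} (s : ℝ) (O : (Fin m → ℝ) →ₗ[ℝ] (Fin m → ℝ))
    (x : (Σ _ : Fin t, Fin (m + 1)) → ℝ) (i : Fin t) (k : Fin m) :
    blockRotation s O x ⟨i, k.succ⟩ = s * O (fun k => x ⟨i, k.succ⟩) k := rfl

theorem blockRotation_injective {t m : ℕ} {s : ℝ} (hs : s ≠ 0)
    (O : (Fin m → ℝ) ≃ₗ[ℝ] (Fin m → ℝ)) :
    Function.Injective (blockRotation (t := t) s (O : (Fin m → ℝ) →ₗ[ℝ] (Fin m → ℝ))) := by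
  intro x y hxy
  have h : ∀ i, (fun k : Fin m => x ⟨i, k.succ⟩) = fun k : Fin m => y ⟨i, k.succ⟩ := fun i =>
    O.injective <| funext fun k => mul_left_cancel₀ hs (congrFun hxy ⟨i, k.succ⟩)
  funext ⟨i, k⟩
  refine Fin.cases ?_ (fun k => ?_) k
  · exact mul_left_cancel₀ hs (congrFun hxy ⟨i, 0⟩)
  · exact congrFun (h i) k

theorem blockRotation_mem_iff {t m : ℕ} {s : ℝ} (hs : 0 < s)
    (O : (Fin m → ℝ) →ₗ[ℝ] (Fin m → ℝ)) (hO : ∀ x, O x ⬝ᵥ O x = x ⬝ᵥ x)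
    (x : (Σ _ : Fin t, Fin (m + 1)) → ℝ) :
    blockRotation s O x ∈ prodSecondOrderCone (fun _ => m) ↔
      x ∈ prodSecondOrderCone (fun _ => m) := by
  refine forall_congr' fun i => ?_
  rw [mem_secondOrderCone_iff, mem_secondOrderCone_iff, blockRotation_zero,
    mul_nonneg_iff_of_pos_left hs]
  have hl : lorentz (fun k => blockRotation s O x ⟨i, k⟩) (fun k => blockRotation s O x ⟨i, k⟩) =
      s ^ 2 * lorentz (fun k => x ⟨i, k⟩) (fun k => x ⟨i, k⟩) := by
    have h := hO fun k => x ⟨i, k.succ⟩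
    simp only [dotProduct] at h
    simp only [lorentz, blockRotation_zero, blockRotation_succ]
    rw [mul_sub, ← h, Finset.mul_sum]
    congr 1
    · ring
    · exact Finset.sum_congr rfl fun k _ => by ring
  rw [hl, mul_nonneg_iff_of_pos_left (by positivity)]

namespace SOCSystem

theorem reducesTo_smul_column {t : ℕ} {d : Fin t → ℕ}
    (A : Matrix (Σ i : Fin t, Fin (d i + 1)) (Fin 1) ℝ)
    (b : (Σ i : Fin t, Fin (d i + 1)) → ℝ) {a : ℝ} (ha : a ≠ 0) :
    ReducesTo ⟨1, t, d, A, b⟩ ⟨1, t, d, fun r j => A r j * a, b⟩ := by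
  have h := Step.contract A b 0 (fun _ => a) 0 ha
  have hA : A.updateCol 0 (A *ᵥ fun _ => a) = fun r j => A r j * a := by
    funext r j
    obtain rfl : j = 0 := Subsingleton.elim _ _
    rw [Matrix.updateCol_self, Matrix.mulVec, dotProduct, Fin.sum_univ_one]
  rw [hA, Matrix.mulVec_zero, add_zero] at h
  exact Relation.ReflTransGen.single h

/-- A one-variable system with a single block whose right-hand side is a nonzero boundary point and
whose column is tangent there, but not a multiple of it, reduces to a minor. -/
theorem reducesTo_minor_of_tangent {m : ℕ} {z v : Fin (m + 1) → ℝ} (h0 : 0 < z 0)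
    (hz : lorentz z z = 0) (hzv : lorentz z v = 0) (hne : ∀ a : ℝ, v ≠ a • z) :
    ∃ α, ReducesTo ⟨1, 1, fun _ => m, fun r _ => v r.2, fun r => z r.2⟩ (minor α) := by
  let p : Fin m → ℝ := fun k => (z 0)⁻¹ * z k.succ
  -- Here `z` is `z 0` times `(1, p)` with `p` a unit vector. Tangency says that the tail of `v` has
  -- component `v 0` along `p`, so `w` is orthogonal to `p`; it is nonzero because `v` is not a
  -- multiple of `z`.
  let w : Fin m → ℝ := fun k => v k.succ - v 0 * p k
  have hzp : (fun k : Fin m => z k.succ) = z 0 • p := by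
    funext k
    exact (mul_inv_cancel_left₀ h0.ne' _).symm
  have hpp : p ⬝ᵥ p = 1 := by
    have : z 0 * z 0 * (p ⬝ᵥ p) = z 0 * z 0 := by
      rw [lorentz, sub_eq_zero] at hz
      change _ = (fun k : Fin m => z k.succ) ⬝ᵥ (fun k : Fin m => z k.succ) at hz
      rw [hzp, dotProduct_smul, smul_dotProduct, smul_eq_mul, smul_eq_mul] at hz
      rw [mul_assoc, ← hz]
    exact mul_left_cancel₀ (mul_pos h0 h0).ne' (by rw [this, mul_one])
  have hvw : (fun k : Fin m => v k.succ) = v 0 • p + w := by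
    funext k
    simp [w]
  have hpw : p ⬝ᵥ w = 0 := by
    rw [lorentz, sub_eq_zero] at hzv
    change _ = (fun k : Fin m => z k.succ) ⬝ᵥ (fun k : Fin m => v k.succ) at hzv
    rw [hzp, hvw, smul_dotProduct, smul_eq_mul] at hzv
    have := mul_left_cancel₀ h0.ne' hzv
    rw [dotProduct_add, dotProduct_smul, hpp, smul_eq_mul, mul_one] at this
    linarith
  have hww : 0 < w ⬝ᵥ w := by
    refine (Finset.sum_nonneg fun k _ => mul_self_nonneg _).lt_of_ne fun h => ?_
    have hw0 : w = 0 := dotProduct_self_eq_zero.1 h.symm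
    refine hne (v 0 * (z 0)⁻¹) (funext fun k => ?_)
    refine Fin.cases ?_ (fun k => ?_) k
    · simp [h0.ne']
    · have := congrFun hw0 k
      simp only [w, p, Pi.zero_apply] at this
      rw [Pi.smul_apply, smul_eq_mul]
      linarith
  obtain ⟨ρ, hρ, hρw⟩ : ∃ ρ : ℝ, 0 < ρ ∧ ρ * ρ = w ⬝ᵥ w :=
    ⟨√(w ⬝ᵥ w), Real.sqrt_pos.2 hww, Real.mul_self_sqrt hww.le⟩
  obtain ⟨hm, O, hO, hOp, hOq⟩ := exists_linearEquiv_orthonormal_pair p (ρ⁻¹ • w) hpp (by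
    rw [dotProduct_smul, smul_dotProduct, smul_eq_mul, smul_eq_mul, ← hρw]
    field_simp) (by rw [dotProduct_smul, hpw, smul_zero])
  have hOw : O w = ρ • Pi.single ⟨1, by omega⟩ 1 := by
    rw [← hOq, map_smul, smul_smul, mul_inv_cancel₀ hρ.ne', one_smul]
  have hs : 0 < (z 0)⁻¹ := inv_pos.2 h0
  let e := LinearEquiv.ofInjectiveEndo _ (blockRotation_injective (t := 1) hs.ne' O)
  have he : ∀ x, e x = blockRotation (z 0)⁻¹ (O : (Fin m → ℝ) →ₗ[ℝ] (Fin m → ℝ)) x :=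
    fun x => rfl
  let f : Fin (2 + 1) ↪o Fin (m + 1) := Fin.castLEOrderEmb (by omega)
  -- After the rotation and the scaling by `(z 0)⁻¹`, the first three rows of `z` are `(1, 1, 0)`
  -- and those of `v` are `(v 0, v 0, ρ) / z 0`; multiplying the column by `z 0 / ρ` gives this `α`.
  refine ⟨v 0 / ρ, (reducesTo_of_linearEquiv (t := 1) (d := fun _ => m) (fun r (_ : Fin 1) => v r.2)
    (fun r => z r.2) e fun x => ?_).trans (Relation.ReflTransGen.head
      (Step.deleteRows (d' := fun _ => 2) _ _ (fun _ => f) fun _ => rfl) ?_)⟩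
  · rw [he]
    exact blockRotation_mem_iff hs _ hO x
  · have hez : ∀ i k, e (fun r => z r.2) ⟨i, f k⟩ = (![1, 1, 0] : Fin 3 → ℝ) k := by
      intro i k
      rw [he]
      fin_cases k
      · show (z 0)⁻¹ * z 0 = 1
        exact inv_mul_cancel₀ h0.ne'
      · show (z 0)⁻¹ * O (fun k => z k.succ) ⟨0, _⟩ = 1
        rw [hzp, map_smul, hOp]
        simp [h0.ne']
      · show (z 0)⁻¹ * O (fun k => z k.succ) ⟨1, _⟩ = 0
        rw [hzp, map_smul, hOp]
        simp
    have hev : ∀ i k, e (fun r => v r.2) ⟨i, f k⟩ * (z 0 / ρ) =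
        (![v 0 / ρ, v 0 / ρ, 1] : Fin 3 → ℝ) k := by
      intro i k
      rw [he]
      fin_cases k
      · show (z 0)⁻¹ * v 0 * (z 0 / ρ) = v 0 / ρ
        field_simp
      · show (z 0)⁻¹ * O (fun k => v k.succ) ⟨0, _⟩ * (z 0 / ρ) = v 0 / ρ
        rw [hvw, map_add, map_smul, hOp, hOw]
        simp
        field_simp
      · show (z 0)⁻¹ * O (fun k => v k.succ) ⟨1, _⟩ * (z 0 / ρ) = 1
        rw [hvw, map_add, map_smul, hOp, hOw]
        simp
        field_simp
    have hscale := reducesTo_smul_column (t := 1) (d := fun _ => 2)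
      (fun r _ => e (fun s => v s.2) ⟨r.1, f r.2⟩) (fun r => e (fun s => z s.2) ⟨r.1, f r.2⟩)
      (div_pos h0 hρ).ne'
    simp only [hev] at hscale
    have hmin : minor (v 0 / ρ) = ⟨1, 1, fun _ => 2,
        fun r _ => (![v 0 / ρ, v 0 / ρ, 1] : Fin 3 → ℝ) r.2,
        fun r => e (fun s => z s.2) ⟨r.1, f r.2⟩⟩ := by
      simp only [hez]
      rfl
    rw [hmin]
    exact hscale

end SOCSystem

theorem corollary4p1 (S : SOCSystem) (hS : S.BadlyBehaved) :
    ∃ α : ℝ, S.ReducesTo (SOCSystem.minor α) := by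
  obtain ⟨n, t, d, A, b⟩ := S
  have hbad := mt conicWellBehaved_of_tangent_eq_smul hS
  push Not at hbad
  obtain ⟨x, -, i, h0, hz, u, hzv, hne⟩ := hbad
  obtain ⟨j, hj⟩ : ∃ j, u j ≠ 0 := by
    by_contra! hu
    refine hne 0 ?_
    rw [show u = 0 from funext hu, Matrix.mulVec_zero, map_zero, zero_smul]
  obtain ⟨α, hα⟩ := SOCSystem.reducesTo_minor_of_tangent h0 hz hzv hne
  -- The contraction with coefficients `u` and `-x` makes column `j` equal to `A u` and the
  -- right-hand side equal to the slack `b - A x`.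
  refine ⟨α, Relation.ReflTransGen.head (SOCSystem.Step.contract A b j u (-x) hj)
    ((SOCSystem.reducesTo_single_column n _ _ j).trans
      ((SOCSystem.reducesTo_single_block t d _ _ i).trans ?_))⟩
  have hA : (fun r (_ : Fin 1) => A.updateCol j (A *ᵥ u) ⟨i, r.2⟩ j) =
      fun (r : Σ _ : Fin 1, Fin (d i + 1)) _ => blockMap d i (A *ᵥ u) r.2 := by
    funext r k
    exact Matrix.updateCol_self ..
  have hb : (fun r => (b + A *ᵥ (-x)) ⟨i, r.2⟩) =
      fun (r : Σ _ : Fin 1, Fin (d i + 1)) => blockMap d i (b - A *ᵥ x) r.2 := by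
    rw [Matrix.mulVec_neg, ← sub_eq_add_neg]
    rfl
  rw [hA, hb]
  exact hα
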